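/- Let $p$ be a prime and let $G$ be a finite $p$-group of nilpotence class $3$ that is a Camina group, i.e. for every $g \in G \setminus G'$ the conjugacy class of $g$ is the coset $gG'$. Write $G_3 = [G',G]$. For $a \in G\setminus G'$ let $A(a) = \{x \in G \mid [a,x] \in G_3\}$, i.e. $A(a)/G_3 = C_{G/G_3}(aG_3)$, and put $\mathcal{A}(G) = \{A(a) \mid a \in G\setminus G'\}$. For a subgroup $N \le G_3$ with $|G_3:N| = p$ (such an $N$ is central, hence normal, in $G$) let $C(N)$ be the subgroup of $G$ with $N \le C(N)$ and $C(N)/N = C_{G/N}(G'/N)$, and put $\mathcal{C}(G) = \{C(N) \mid N \le G_3,\ |G_3:N| = p\}$. If $\mathcal{C}(G)$ is a proper subset of $\mathcal{A}(G)$, then $|G_3| \le |G:G'|^{1/2}$. -/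

import Mathlib

namespace CaminaGroups

/-- `G` is a Camina group: the conjugacy class of every `g` outside the derived subgroup `G'`
is the whole coset `gG'`. -/
def IsCamina (G : Type*) [Group G] : Prop :=
  ∀ g : G, g ∉ commutator G → conjugatesOf g = (fun z => g * z) '' (commutator G : Set G)

/-- The third term `G_3 = [G', G]` of the lower central series (with `G_2 = G'`). -/
abbrev third (G : Type*) [Group G] : Subgroup G :=
  ⁅commutator G, (⊤ : Subgroup G)⁆

/-- For a normal subgroup `N` and a subset `S` of `G`, the full preimage in `G` of the
centralizer in `G/N` of the image of `S`. -/
def centralizerMod {G : Type*} [Group G] (N : Subgroup G) [N.Normal] (S : Set G) : Subgroup G :=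
  (Subgroup.centralizer (QuotientGroup.mk' N '' S)).comap (QuotientGroup.mk' N)

/-- Membership in commutator form. -/
theorem mem_centralizerMod {G : Type*} [Group G] {N : Subgroup G} [N.Normal] {S : Set G} {x : G} :
    x ∈ centralizerMod N S ↔ ∀ s ∈ S, s⁻¹ * x⁻¹ * s * x ∈ N := by
  simp only [centralizerMod, Subgroup.mem_comap, Subgroup.mem_centralizer_iff,
    Set.forall_mem_image]
  refine forall₂_congr fun s _ => ?_
  have e : s⁻¹ * x⁻¹ * s * x = (x * s)⁻¹ * (s * x) := by group
  rw [e, ← QuotientGroup.eq, eq_comm]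
  rfl

/-- `A(a)`, the subgroup with `A(a)/G_3 = C_{G/G_3}(aG_3)`. -/
def subgroupA {G : Type*} [Group G] (a : G) : Subgroup G :=
  centralizerMod (third G) {a}

/-- `C(N)`, the subgroup with `C(N)/N = C_{G/N}(G'/N)`. -/
def subgroupC {G : Type*} [Group G] (N : Subgroup G) [N.Normal] : Subgroup G :=
  centralizerMod N (commutator G : Set G)

/-- `𝒜(G) = {A(a) | a ∈ G ∖ G'}`. -/
def familyA (G : Type*) [Group G] : Set (Subgroup G) :=
  {A | ∃ a : G, a ∉ commutator G ∧ A = subgroupA a}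

/-- `𝒞(G) = {C(N) | N ≤ G_3, |G_3 : N| = p}`. Normality of `N` is what makes `G/N` meaningful;
it is automatic when `G` has class at most `3` (see `normal_of_le_third`). -/
def familyC (p : ℕ) (G : Type*) [Group G] : Set (Subgroup G) :=
  {C | ∃ (N : Subgroup G) (_ : N.Normal), N ≤ third G ∧ N.relIndex (third G) = p ∧
    C = subgroupC N}

/-- In a group of nilpotence class `3`, every subgroup of `G_3` is normal. -/
theorem normal_of_le_third {G : Type*} [Group G] [Group.IsNilpotent G]
    (hc : Group.nilpotencyClass G = 3) {N : Subgroup G} (hN : N ≤ third G) : N.Normal := by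
  have h : (⊤ : Subgroup G).lowerCentralSeries 3 = ⊥ := by
    rw [← hc]; exact Subgroup.lowerCentralSeries_nilpotencyClass
  have h3 : ⁅third G, (⊤ : Subgroup G)⁆ = ⊥ := by
    rw [← h]; rfl
  have h4 := Subgroup.commutator_eq_bot_iff_le_centralizer.mp h3
  refine ⟨fun n hn g => ?_⟩
  have := Subgroup.mem_centralizer_iff.mp (h4 (hN hn)) g (Subgroup.mem_top g)
  rw [this, mul_inv_cancel_right]
  exact hn

end CaminaGroups

/-! Put V = G/G' and W = G'/G_3, elementary abelian p-groups. The commutator induces an alternating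
map B : V × V → W, and the Camina condition makes B(x, ·) onto W for every x ≠ 0.

Composing B with functionals t on W gives a pencil of alternating forms, nondegenerate for t ≠ 0.
Its determinant is a square q², where q (the Pfaffian) has degree at most (dim V)/2 and vanishes
only at t = 0. By Chevalley–Warning deg q ≥ dim W, so |G':G_3|² ≤ |G:G'|
(`two_mul_finrank_le_of_surjective`).

This bound and a dimension count show that each C(N)/G_3 is abelian (`eq_zero_of_mem_ker_flip`).
Choose A(b) outside 𝒞(G). If [G',b] ≠ G_3, it lies in some N of index p, so b ∈ C(N) and C(N) ≤
A(b). But C(N) is some A(a), and all A(a) have index |W|, so A(b) = C(N), a contradiction. Hence c ↦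
[c,b] maps G'/G_3 onto G_3, and |G_3| ≤ |G':G_3|. -/

namespace CaminaGroups

open Module MvPolynomial

/-! ### Determinants of alternating matrices -/

section AlternatingDet

/-- The determinant of an alternating matrix over a field is a square. -/
theorem isSquare_det_of_alternating {K : Type*} [Field K] {ι : Type*} [Fintype ι] [DecidableEq ι]
    (A : Matrix ι ι K) (hdiag : ∀ i, A i i = 0) (hskew : ∀ i j, A j i = -A i j) :
    IsSquare A.det := by
  induction hn : Fintype.card ι using Nat.strong_induction_on generalizing ι with
  | _ n ih =>
  by_cases hA : A = 0
  · subst hA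
    cases isEmpty_or_nonempty ι
    · rw [Matrix.det_isEmpty]; exact IsSquare.one
    · rw [Matrix.det_zero]; exact IsSquare.zero
  obtain ⟨i, j, hij⟩ : ∃ i j, A i j ≠ 0 := by
    by_contra! h
    exact hA (Matrix.ext h)
  have hne : i ≠ j := by rintro rfl; exact hij (hdiag i)
  let s : Fin 2 → {k // k = i ∨ k = j} := ![⟨i, Or.inl rfl⟩, ⟨j, Or.inr rfl⟩]
  have hs : Function.Bijective s := by
    constructor
    · intro a b hab
      have h : (s a : ι) = s b := congrArg Subtype.val hab
      fin_cases a <;> fin_cases b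
      exacts [rfl, absurd h hne, absurd h.symm hne, rfl]
    · rintro ⟨k, rfl | rfl⟩
      · exact ⟨0, rfl⟩
      · exact ⟨1, rfl⟩
  -- Reindexing puts the nonzero entry `A i j` in a leading 2 × 2 block. That block has square
  -- determinant, and its Schur complement is again alternating, so induction applies.
  let e : Fin 2 ⊕ {k // ¬ (k = i ∨ k = j)} ≃ ι :=
    ((Equiv.ofBijective s hs).sumCongr (Equiv.refl _)).trans (Equiv.sumCompl _)
  let M := A.submatrix e e
  have hMd : ∀ a, M a a = 0 := fun a => hdiag _
  have hMs : ∀ a b, M b a = -M a b := fun a b => hskew _ _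
  have h01 : M (Sum.inl 0) (Sum.inl 1) = A i j := rfl
  have h11 : M.toBlocks₁₁.det = A i j * A i j := by
    rw [Matrix.det_fin_two]
    simp only [Matrix.toBlocks₁₁, Matrix.of_apply, hMd, hMs (Sum.inl 0) (Sum.inl 1), h01]
    ring
  have hu : IsUnit M.toBlocks₁₁.det := by
    rw [h11]; exact (mul_ne_zero hij hij).isUnit
  let := M.toBlocks₁₁.invertibleOfIsUnitDet hu
  have hdet : A.det = M.det := (Matrix.det_submatrix_equiv_self e A).symm
  rw [hdet, ← Matrix.fromBlocks_toBlocks M, Matrix.det_fromBlocks₁₁, h11]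
  refine IsSquare.mul ⟨_, rfl⟩ ?_
  have hinv : ∀ a, (⅟M.toBlocks₁₁) a a = 0 ∧ ∀ b, (⅟M.toBlocks₁₁) b a = -(⅟M.toBlocks₁₁) a b := by
    rw [Matrix.invOf_eq_nonsing_inv, Matrix.inv_def, Matrix.adjugate_fin_two]
    intro a
    have hd : ∀ a, M.toBlocks₁₁ a a = 0 := fun a => hMd _
    have hk : M.toBlocks₁₁ 1 0 = - M.toBlocks₁₁ 0 1 := hMs _ _
    fin_cases a <;> refine ⟨by simp [hd], fun b => ?_⟩ <;> fin_cases b <;> simp [hd, hk]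
  have hsub : ∀ a b, (M.toBlocks₂₁ * ⅟M.toBlocks₁₁ * M.toBlocks₁₂) a b =
      M.toBlocks₂₁ a 0 * (⅟M.toBlocks₁₁) 0 1 * M.toBlocks₁₂ 1 b
        + M.toBlocks₂₁ a 1 * (⅟M.toBlocks₁₁) 1 0 * M.toBlocks₁₂ 0 b := by
    intro a b
    simp only [Matrix.mul_apply, Fin.sum_univ_two, (hinv _).1]
    ring
  have h12 : ∀ a b, M.toBlocks₁₂ b a = - M.toBlocks₂₁ a b := fun a b => hMs _ _
  refine ih _ ?_ _ ?_ ?_ rfl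
  · rw [← hn]
    exact Fintype.card_subtype_lt (x := i) (by simp)
  · intro a
    rw [Matrix.sub_apply, hsub, h12, h12, (hinv 0).2 1]
    simp only [Matrix.toBlocks₂₂, Matrix.of_apply, hMd]
    ring
  · intro a b
    rw [Matrix.sub_apply, Matrix.sub_apply, hsub, hsub, h12, h12, h12, h12, (hinv 0).2 1]
    simp only [Matrix.toBlocks₂₂, Matrix.of_apply, hMs (Sum.inr a) (Sum.inr b)]
    ring

/-- The determinant of an alternating matrix over an integrally closed domain is a square. -/
theorem isSquare_det_of_alternating_of_isIntegrallyClosed {R : Type*} [CommRing R] [IsDomain R]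
    [IsIntegrallyClosed R] {ι : Type*} [Fintype ι] [DecidableEq ι]
    (A : Matrix ι ι R) (hdiag : ∀ i, A i i = 0) (hskew : ∀ i j, A j i = -A i j) :
    IsSquare A.det := by
  obtain ⟨y, hy⟩ := isSquare_det_of_alternating (A.map (algebraMap R (FractionRing R)))
    (by simp [hdiag]) (fun i j => by simp [hskew i j])
  have hy' : algebraMap R (FractionRing R) A.det = y ^ 2 := by
    rw [pow_two, ← hy, RingHom.map_det]; rfl
  -- The root `y` in the fraction field is integral because its square lies in `R`.
  obtain ⟨x, rfl⟩ := IsIntegrallyClosed.exists_algebraMap_eq_of_isIntegral_pow (R := R) (x := y)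
    two_pos (hy' ▸ isIntegral_algebraMap)
  refine ⟨x, IsFractionRing.injective R (FractionRing R) ?_⟩
  rw [hy', pow_two, map_mul]

end AlternatingDet

/-! ### Dimension bounds for bilinear maps -/

theorem isHomogeneous_det {R σ ι : Type*} [CommRing R] [Fintype ι] [DecidableEq ι]
    (A : Matrix ι ι (MvPolynomial σ R)) (hA : ∀ i j, (A i j).IsHomogeneous 1) :
    A.det.IsHomogeneous (Fintype.card ι) := by
  rw [Matrix.det_apply, ← mem_homogeneousSubmodule]
  refine Submodule.sum_mem _ fun g _ => ?_
  rw [Units.smul_def]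
  refine zsmul_mem ?_ _
  rw [mem_homogeneousSubmodule]
  have := IsHomogeneous.prod Finset.univ (fun i => A (g i) i) (fun _ => 1) fun i _ => hA _ _
  simpa using this

/-- If every vector `x ≠ 0` is paired by an alternating bilinear map `V × V → W` over a finite
field onto the whole of `W`, then `2 dim W ≤ dim V`. -/
theorem two_mul_finrank_le_of_surjective {F V W : Type*} [Field F] [Finite F]
    [AddCommGroup V] [Module F V] [AddCommGroup W] [Module F W]
    [FiniteDimensional F V] [FiniteDimensional F W] [Nontrivial V]
    (B : V →ₗ[F] V →ₗ[F] W) (hB : B.IsAlt)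
    (hsurj : ∀ x, x ≠ 0 → Function.Surjective (B x)) :
    2 * finrank F W ≤ finrank F V := by
  classical
  have := Fintype.ofFinite F
  obtain ⟨p, hchar⟩ := CharP.exists F
  let v := finBasis F V
  let w := finBasis F W
  let σ := Fin (finrank F W)
  -- Generic member of the pencil: evaluation at `t` gives the Gram matrix of `t ∘ B`.
  let P : Matrix (Fin (finrank F V)) (Fin (finrank F V)) (MvPolynomial σ F) :=
    Matrix.of fun j k => ∑ i, C (w.repr (B (v j) (v k)) i) * X i
  have hPd : ∀ j, P j j = 0 := fun j => by simp [P, hB.self_eq_zero]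
  have hPs : ∀ j k, P k j = - P j k := fun j k => by
    have : B (v k) (v j) = - B (v j) (v k) := (hB.neg (v j) (v k)).symm
    simp [P, this]
  obtain ⟨q, hq⟩ := isSquare_det_of_alternating_of_isIntegrallyClosed P hPd hPs
  have hdeg : P.det.totalDegree ≤ finrank F V := by
    refine (isHomogeneous_det P fun j k => ?_).totalDegree_le.trans (by simp)
    simp only [P, Matrix.of_apply]
    refine IsHomogeneous.sum _ _ _ fun i _ => ?_
    simpa using (isHomogeneous_C σ (w.repr (B (v j) (v k)) i)).mul (isHomogeneous_X F i)
  have heval : ∀ t : σ → F, eval t q * eval t q =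
      (LinearMap.toMatrix₂ v v (B.compr₂ (∑ i, t i • w.coord i))).det := by
    intro t
    rw [← map_mul, ← hq, RingHom.map_det]
    congr 1
    ext j k
    simp only [P, RingHom.mapMatrix_apply, Matrix.map_apply, Matrix.of_apply, map_sum, map_mul,
      eval_C, eval_X, LinearMap.toMatrix₂_apply, LinearMap.compr₂_apply, LinearMap.sum_apply,
      LinearMap.smul_apply, smul_eq_mul, Basis.coord_apply]
    exact Finset.sum_congr rfl fun i _ => mul_comm _ _
  have hzero : ∀ t : σ → F, eval t q = 0 → t = 0 := by
    intro t ht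
    by_contra hne
    have hd := heval t
    rw [ht, mul_zero] at hd
    obtain ⟨i, hi⟩ := Function.ne_iff.1 hne
    refine absurd hd.symm ((LinearMap.separatingLeft_iff_det_ne_zero (B := B.compr₂ _) v).1 ?_)
    intro x hx
    by_contra hx0
    obtain ⟨y, hy⟩ := hsurj x hx0 (w i)
    refine hi (.trans ?_ (hx y))
    simp [hy, Finsupp.single_apply]
    exact (Fintype.sum_ite_eq i t).symm
  have hq0 : eval 0 q = 0 := by
    have := heval 0
    -- The matrix must be nonempty: an empty determinant would be 1.
    have hn : Nonempty (Fin (finrank F V)) := ⟨⟨0, finrank_pos⟩⟩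
    have h0 : B.compr₂ (∑ i, (0 : σ → F) i • w.coord i) = 0 := by ext; simp
    rw [h0, map_zero, Matrix.det_zero] at this
    exact mul_self_eq_zero.1 this
  have hle : finrank F W ≤ q.totalDegree := by
    by_contra! hlt
    -- Chevalley–Warning: below this degree the number of zeros is divisible by the characteristic,
    -- yet 0 is the only zero.
    have hdvd := char_dvd_card_solutions p (f := q) (by simpa [σ] using hlt)
    have : Fintype.card {x : σ → F // eval x q = 0} = 1 := by
      rw [Fintype.card_eq_one_iff]
      exact ⟨⟨0, hq0⟩, fun y => Subtype.ext (hzero _ y.2)⟩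
    rw [this, Nat.dvd_one] at hdvd
    exact CharP.char_ne_one F p hdvd
  rcases eq_or_ne q 0 with rfl | hqne
  · rw [totalDegree_zero] at hle
    lia
  · rw [hq, totalDegree_mul_of_isDomain hqne hqne] at hdeg
    omega

/-- Let `B : V × V → W` be alternating, onto `W` in its second argument for each nonzero first
argument, with `2 dim W ≤ dim V`, and let `T : W × V → F` be nonzero and bilinear.
If `B` maps pairs from the right radical of `T` to the left radical of `T`, then it vanishes on
such pairs. -/
theorem eq_zero_of_mem_ker_flip {F V W : Type*} [Field F]
    [AddCommGroup V] [Module F V] [AddCommGroup W] [Module F W]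
    [FiniteDimensional F V] [FiniteDimensional F W]
    (B : V →ₗ[F] V →ₗ[F] W) (hsurj : ∀ x, x ≠ 0 → Function.Surjective (B x))
    (hdim : 2 * finrank F W ≤ finrank F V)
    (T : W →ₗ[F] V →ₗ[F] F) (hT : T ≠ 0)
    (hBT : ∀ x y, T.flip x = 0 → T.flip y = 0 → T (B x y) = 0)
    {x y : V} (hx : T.flip x = 0) (hy : T.flip y = 0) : B x y = 0 := by
  obtain ⟨v, hv⟩ : ∃ v, T.flip v ≠ 0 := by
    by_contra! h
    exact hT (by ext w v; exact LinearMap.congr_fun (h v) w)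
  -- This gives rank T ≤ dim W - dim ker T.
  have hrange : finrank F (LinearMap.range T.flip) ≤
      finrank F (LinearMap.ker T).dualAnnihilator := by
    refine Submodule.finrank_mono ?_
    rintro _ ⟨u, rfl⟩
    rw [Submodule.mem_dualAnnihilator]
    intro w hw
    rw [LinearMap.flip_apply, LinearMap.mem_ker.1 hw, LinearMap.zero_apply]
  -- The form T(B(·,·), v) is nondegenerate on V and the right radical of T is totally isotropic for
  -- it, so the radical has dimension at most (dim V)/2. Hence rank T ≥ (dim V)/2 ≥ dim W, which
  -- forces ker T = 0.
  have hiso : finrank F (LinearMap.ker T.flip) ≤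
      finrank F (LinearMap.ker T.flip).dualAnnihilator := by
    let β : V →ₗ[F] Dual F V := B.compr₂ (T.flip v)
    have hβ : Function.Injective β := by
      rw [injective_iff_map_eq_zero]
      intro u hu
      by_contra hu0
      refine hv (LinearMap.ext fun w => ?_)
      obtain ⟨y, rfl⟩ := hsurj u hu0 w
      exact LinearMap.congr_fun hu y
    rw [(Submodule.equivMapOfInjective β hβ _).finrank_eq]
    refine Submodule.finrank_mono ?_
    rintro _ ⟨u, hu, rfl⟩
    rw [Submodule.mem_dualAnnihilator]
    intro u' hu'
    exact LinearMap.congr_fun (hBT u u' hu hu') v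
  have h1 := Subspace.finrank_add_finrank_dualAnnihilator_eq (LinearMap.ker T)
  have h2 := Subspace.finrank_add_finrank_dualAnnihilator_eq (LinearMap.ker T.flip)
  have h3 := LinearMap.finrank_range_add_finrank_ker T.flip
  have hker : LinearMap.ker T = ⊥ := by
    rw [← Submodule.finrank_eq_zero (R := F)]
    omega
  exact LinearMap.ker_eq_bot'.1 hker _ (hBT x y hx hy)

end CaminaGroups

namespace CaminaGroups

/-! ### Commutator maps between the lower central factors -/

open Module
open scoped commutatorElement

/-- A map on abelian groups of exponent `n` that is multiplicative in both variables, as a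
bilinear map over `ZMod n`. -/
def bilinOfMul (n : ℕ) {A B C : Type*} [CommGroup A] [CommGroup B] [AddCommGroup C]
    [Module (ZMod n) (Additive A)] [Module (ZMod n) (Additive B)] [Module (ZMod n) C]
    (f : A → B → C) (hl : ∀ a a' b, f (a * a') b = f a b + f a' b)
    (hr : ∀ a b b', f a (b * b') = f a b + f a b') :
    Additive A →ₗ[ZMod n] Additive B →ₗ[ZMod n] C :=
  let g (a : Additive A) : Additive B →+ C :=
    AddMonoidHom.mk' (fun b => f a.toMul b.toMul) fun b b' => hr a.toMul b.toMul b'.toMul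
  (AddMonoidHom.mk' (fun a => (g a).toZModLinearMap n)
    fun a a' => LinearMap.ext fun b => hl a.toMul a'.toMul b.toMul).toZModLinearMap n

variable {G : Type*} [Group G]

/-- The two commutator conventions agree modulo a normal subgroup, since ab ∈ N iff ba ∈ N. -/
theorem mem_centralizerMod_iff {N : Subgroup G} [N.Normal] {S : Set G} {x : G} :
    x ∈ centralizerMod N S ↔ ∀ s ∈ S, ⁅s, x⁆ ∈ N := by
  rw [mem_centralizerMod]
  refine forall₂_congr fun s _ => ?_
  have h1 : s⁻¹ * x⁻¹ * s * x = (x * s)⁻¹ * (s * x) := by group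
  have h2 : ⁅s, x⁆ = s * x * (x * s)⁻¹ := by group
  rw [h1, h2]
  exact ‹N.Normal›.mem_comm_iff

theorem mem_subgroupA {a x : G} : x ∈ subgroupA a ↔ ⁅a, x⁆ ∈ third G := by
  simp [subgroupA, mem_centralizerMod_iff]

theorem mem_subgroupC {N : Subgroup G} [N.Normal] {x : G} :
    x ∈ subgroupC N ↔ ∀ c ∈ commutator G, ⁅c, x⁆ ∈ N :=
  mem_centralizerMod_iff

theorem commutator_mem_commutator' (x y : G) : ⁅x, y⁆ ∈ commutator G :=
  Subgroup.commutator_mem_commutator (Subgroup.mem_top x) (Subgroup.mem_top y)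

theorem commutator_mem_third {c : G} (hc : c ∈ commutator G) (y : G) : ⁅c, y⁆ ∈ third G :=
  Subgroup.commutator_mem_commutator hc (Subgroup.mem_top y)

theorem third_le_commutator : third G ≤ commutator G :=
  Subgroup.commutator_mono le_top le_rfl

/-- A commutator of two elements commuting with `G'` modulo `N` is central modulo `N`. -/
theorem commutator_commutator_mem {N : Subgroup G} [N.Normal] {x y : G} (hx : x ∈ subgroupC N)
    (hy : y ∈ subgroupC N) (z : G) : ⁅⁅x, y⁆, z⁆ ∈ N := by
  have hmap : QuotientGroup.mk' N '' (commutator G : Set G) = commutator (G ⧸ N) := by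
    rw [← Subgroup.coe_map, commutator_def, Subgroup.map_commutator,
      Subgroup.map_top_of_surjective _ (QuotientGroup.mk'_surjective N), commutator_def]
  rw [subgroupC, centralizerMod, Subgroup.mem_comap, hmap] at hx hy
  -- An instance of the three subgroups lemma, applied in G/N.
  have h := commutator_centralizer_commutator_le_center (G ⧸ N)
    (Subgroup.commutator_mem_commutator hx hy)
  have h' := Subgroup.mem_center_iff.1 h (QuotientGroup.mk' N z)
  rw [← QuotientGroup.eq_one_iff, ← QuotientGroup.mk'_apply, map_commutatorElement,
    map_commutatorElement, commutatorElement_eq_one_iff_mul_comm]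
  exact h'.symm

/-- The section `G' / G_3`. -/
abbrev DerivedQuotient (G : Type*) [Group G] : Type _ :=
  ↥(commutator G) ⧸ (third G).subgroupOf (commutator G)

namespace DerivedQuotient

theorem mk_eq_of_commutator_mem {c d : commutator G} (h : (c : G)⁻¹ * d ∈ third G) :
    (c : DerivedQuotient G) = d :=
  QuotientGroup.eq.2 (Subgroup.mem_subgroupOf.2 h)

instance : CommGroup (DerivedQuotient G) :=
  { (inferInstance : Group (DerivedQuotient G)) with
    mul_comm := by
      rintro ⟨c⟩ ⟨d⟩
      refine mk_eq_of_commutator_mem (c := c * d) (d := d * c) ?_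
      have h : ((c * d : commutator G) : G)⁻¹ * (d * c : commutator G) = ⁅(d : G)⁻¹, (c : G)⁻¹⁆ := by
        push_cast; group
      rw [h]
      exact commutator_mem_third (inv_mem d.2) _ }

/-- Removes the conjugations from the commutator identities, making the commutator bimultiplicative
modulo G_3. -/
theorem mk_conj (b : G) (c : commutator G) (h : b * c * b⁻¹ ∈ commutator G) :
    ((⟨b * c * b⁻¹, h⟩ : commutator G) : DerivedQuotient G) = c := by
  refine mk_eq_of_commutator_mem ?_
  have e : (b * c * b⁻¹)⁻¹ * (c : G) = (⁅(c : G)⁻¹, b⁆)⁻¹ := by group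
  change (b * c * b⁻¹)⁻¹ * (c : G) ∈ _
  rw [e]
  exact inv_mem (commutator_mem_third (inv_mem c.2) _)

theorem mk_eq_one_iff {c : commutator G} : (c : DerivedQuotient G) = 1 ↔ (c : G) ∈ third G := by
  rw [QuotientGroup.eq_one_iff, Subgroup.mem_subgroupOf]

end DerivedQuotient

open DerivedQuotient

/-- The commutator map `G × G → G' / G_3`. -/
def commutatorHom (G : Type*) [Group G] : G →* G →* DerivedQuotient G :=
  MonoidHom.mk' (fun x => MonoidHom.mk'
      (fun y => ((⟨⁅x, y⁆, commutator_mem_commutator' x y⟩ : commutator G) : DerivedQuotient G))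
      fun y z => by
        have hc : y * ⁅x, z⁆ * y⁻¹ ∈ commutator G :=
          Subgroup.Normal.conj_mem inferInstance _ (commutator_mem_commutator' x z) y
        rw [← mk_conj y ⟨⁅x, z⁆, commutator_mem_commutator' x z⟩ hc, ← QuotientGroup.mk_mul]
        exact congrArg _ (Subtype.ext (by
          simp [commutatorElement_mul_right_eq_mul_conj, mul_assoc])))
    fun x x' => MonoidHom.ext fun y => by
      have hc : x * ⁅x', y⁆ * x⁻¹ ∈ commutator G :=
        Subgroup.Normal.conj_mem inferInstance _ (commutator_mem_commutator' x' y) x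
      rw [MonoidHom.mul_apply, mul_comm]
      simp only [MonoidHom.mk'_apply]
      rw [← mk_conj x ⟨⁅x', y⁆, commutator_mem_commutator' x' y⟩ hc, ← QuotientGroup.mk_mul]
      exact congrArg _ (Subtype.ext (by
          simp [commutatorElement_mul_left_eq_conj_mul, mul_assoc]))

theorem commutatorHom_apply (x y : G) : commutatorHom G x y =
    ((⟨⁅x, y⁆, commutator_mem_commutator' x y⟩ : commutator G) : DerivedQuotient G) := rfl

theorem commutatorHom_eq_one_iff {x y : G} : commutatorHom G x y = 1 ↔ ⁅x, y⁆ ∈ third G :=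
  mk_eq_one_iff

/-- The commutator map on `G / G'` with values in `G' / G_3`. -/
def abelianizationCommutator (G : Type*) [Group G] :
    Abelianization G →* Abelianization G →* DerivedQuotient G :=
  Abelianization.lift
    (MonoidHom.mk' (fun x => Abelianization.lift (commutatorHom G x)) fun x x' => by
      ext y; simp)

/-- The commutator map `G' × G → G_3` followed by a homomorphism on `G_3`, for `G_3` central. -/
def thirdHom (hz : third G ≤ Subgroup.center G) {M : Type*} [CommGroup M] (φ : third G →* M) :
    commutator G →* G →* M :=
  MonoidHom.mk' (fun c => MonoidHom.mk' (fun y => φ ⟨⁅(c : G), y⁆, commutator_mem_third c.2 y⟩)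
      fun y z => by
        rw [← map_mul]
        refine congrArg φ (Subtype.ext ?_)
        have h := Subgroup.mem_center_iff.1 (hz (commutator_mem_third c.2 z)) y
        simp [commutatorElement_mul_right_eq_mul_conj, mul_assoc, h])
    fun c d => MonoidHom.ext fun y => by
      rw [MonoidHom.mul_apply, mul_comm]
      simp only [MonoidHom.mk'_apply]
      rw [← map_mul]
      refine congrArg φ (Subtype.ext ?_)
      have h := Subgroup.mem_center_iff.1 (hz (commutator_mem_third d.2 y)) c
      simp [commutatorElement_mul_left_eq_conj_mul, h]

/-- The map `thirdHom` on `G' / G_3` and `G / G'`. -/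
def derivedQuotientHom (hz : third G ≤ Subgroup.center G) {M : Type*} [CommGroup M]
    (φ : third G →* M) : DerivedQuotient G →* Abelianization G →* M :=
  QuotientGroup.lift _ (MonoidHom.mk' (fun c => Abelianization.lift (thirdHom hz φ c))
      fun c d => by ext y; simp) fun c hc => by
    have hc' := Subgroup.mem_center_iff.1 (hz (Subgroup.mem_subgroupOf.1 hc))
    ext y
    change φ ⟨⁅(c : G), y⁆, _⟩ = 1
    rw [← map_one φ]
    exact congrArg φ (Subtype.ext (commutatorElement_eq_one_iff_mul_comm.2 (hc' y).symm))

theorem IsCamina.exists_commutator_eq (hG : IsCamina G) {x : G} (hx : x ∉ commutator G) {g : G}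
    (hg : g ∈ commutator G) : ∃ y, ⁅x, y⁆ = g := by
  have h : g⁻¹ * x ∈ conjugatesOf x := by
    rw [hG x hx]
    refine ⟨x⁻¹ * g⁻¹ * x, ?_, by group⟩
    simpa using (inferInstance : (commutator G).Normal).conj_mem _ (inv_mem hg) x⁻¹
  obtain ⟨y, hy⟩ := isConj_iff.1 h
  refine ⟨y, ?_⟩
  have e : ⁅x, y⁆ = x * (y * x * y⁻¹)⁻¹ := by group
  rw [e, hy]
  group

theorem IsCamina.commutatorHom_surjective (hG : IsCamina G) {x : G} (hx : x ∉ commutator G) :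
    Function.Surjective (commutatorHom G x) := by
  rintro ⟨g⟩
  obtain ⟨y, hy⟩ := hG.exists_commutator_eq hx g.2
  exact ⟨y, congrArg _ (Subtype.ext hy)⟩

theorem monoidHom_eq_one_of_mem_commutator {M : Type*} [CommGroup M] (f : G →* M) {x : G}
    (hx : x ∈ commutator G) : f x = 1 :=
  Abelianization.commutator_subset_ker f hx

/-! ### Exponent p of G/G' and G'/G_3 -/

section Exponent

variable (hz : third G ≤ Subgroup.center G) (hne : third G ≠ ⊥)
include hz hne

theorem nontrivial_derivedQuotient : Nontrivial (DerivedQuotient G) := by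
  by_contra h
  rw [not_nontrivial_iff_subsingleton] at h
  have hle : commutator G ≤ third G := fun c hc =>
    mk_eq_one_iff.1 (Subsingleton.elim ((⟨c, hc⟩ : commutator G) : DerivedQuotient G) 1)
  refine hne (Subgroup.commutator_top_right_eq_bot_iff_le_center.2 (hle.trans hz))

theorem exists_notMem_commutator : ∃ x : G, x ∉ commutator G := by
  by_contra! h
  have := nontrivial_derivedQuotient hz hne
  have htop : commutator G = ⊤ := (Subgroup.eq_top_iff' _).2 h
  obtain ⟨⟨c⟩, hc⟩ := exists_ne (1 : DerivedQuotient G)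
  refine hc (mk_eq_one_iff.2 ?_)
  have h3 : third G = commutator G := by
    rw [third, htop, ← commutator_def, htop]
  rw [h3]
  exact c.2

variable [Finite G] {p : ℕ} [Fact p.Prime] (hp : IsPGroup p G) (hG : IsCamina G)
include hp hG

/-- Otherwise [x^p, ·] = [x, ·]^p would be onto G'/G_3, making the p-th power map bijective on a
nontrivial finite p-group. -/
theorem IsCamina.pow_mem_commutator (x : G) : x ^ p ∈ commutator G := by
  by_contra hx
  have hsurj : Function.Surjective fun w : DerivedQuotient G => w ^ p := by
    intro w
    obtain ⟨y, hy⟩ := hG.commutatorHom_surjective hx w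
    exact ⟨commutatorHom G x y, by simpa using hy⟩
  have hinj := Finite.injective_iff_surjective.2 hsurj
  have := nontrivial_derivedQuotient hz hne
  have hpW : IsPGroup p (DerivedQuotient G) := (hp.to_subgroup _).to_quotient _
  have hdvd : p ∣ Nat.card (DerivedQuotient G) :=
    hpW.card_eq_or_dvd.resolve_left Finite.one_lt_card.ne'
  obtain ⟨w, hw⟩ := exists_prime_orderOf_dvd_card' p hdvd
  have hw1 : w = 1 := hinj (by simp [← hw, pow_orderOf_eq_one])
  rw [hw1, orderOf_one] at hw
  exact (Fact.out : p.Prime).one_lt.ne hw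

theorem IsCamina.derivedQuotient_pow_eq_one (w : DerivedQuotient G) : w ^ p = 1 := by
  obtain ⟨x, hx⟩ := exists_notMem_commutator hz hne
  obtain ⟨y, rfl⟩ := hG.commutatorHom_surjective hx w
  rw [← map_pow]
  exact monoidHom_eq_one_of_mem_commutator _ (hG.pow_mem_commutator hz hne hp y)

theorem IsCamina.abelianization_pow_eq_one (v : Abelianization G) : v ^ p = 1 := by
  obtain ⟨x, rfl⟩ := QuotientGroup.mk_surjective v
  exact monoidHom_eq_one_of_mem_commutator Abelianization.of
    (hG.pow_mem_commutator hz hne hp x)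

end Exponent

/-- A subgroup of index `p` in `G_3` is the kernel of a homomorphism to the group of order `p`. -/
theorem exists_hom_third_of_relIndex_eq {p : ℕ} [Fact p.Prime] {N : Subgroup G} [N.Normal]
    (hN : N.relIndex (third G) = p) :
    ∃ φ : third G →* Multiplicative (ZMod p), ∀ z, φ z = 1 ↔ (z : G) ∈ N := by
  have hcard : Nat.card (third G ⧸ N.subgroupOf (third G)) = p := hN
  let e : third G ⧸ N.subgroupOf (third G) ≃* Multiplicative (ZMod p) :=
    mulEquivOfPrimeCardEq (p := p) hcard (by simp)
  refine ⟨e.toMonoidHom.comp (QuotientGroup.mk' _), fun z => ?_⟩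
  simp [Subgroup.mem_subgroupOf]

/-! ### Linear algebra applied to G -/

section

variable (hz : third G ≤ Subgroup.center G) (hne : third G ≠ ⊥)
variable [Finite G] {p : ℕ} [Fact p.Prime] (hp : IsPGroup p G) (hG : IsCamina G)
include hz hne hp hG

theorem IsCamina.exists_bilin :
    ∃ (_ : Module (ZMod p) (Additive (Abelianization G)))
      (_ : Module (ZMod p) (Additive (DerivedQuotient G)))
      (B : Additive (Abelianization G) →ₗ[ZMod p] Additive (Abelianization G) →ₗ[ZMod p]
        Additive (DerivedQuotient G)),
      (∀ x y : G, B (.ofMul (.of x)) (.ofMul (.of y)) = .ofMul (commutatorHom G x y)) ∧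
      B.IsAlt ∧ (∀ v, v ≠ 0 → Function.Surjective (B v)) ∧
      2 * finrank (ZMod p) (Additive (DerivedQuotient G)) ≤
        finrank (ZMod p) (Additive (Abelianization G)) := by
  have m₁ : Module (ZMod p) (Additive (Abelianization G)) :=
    AddCommGroup.zmodModule (hG.abelianization_pow_eq_one hz hne hp)
  have m₂ : Module (ZMod p) (Additive (DerivedQuotient G)) :=
    AddCommGroup.zmodModule (hG.derivedQuotient_pow_eq_one hz hne hp)
  let B : Additive (Abelianization G) →ₗ[ZMod p] Additive (Abelianization G) →ₗ[ZMod p]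
      Additive (DerivedQuotient G) := bilinOfMul p
    (fun v w => Additive.ofMul (abelianizationCommutator G v w))
    (fun a a' b => by simp) (fun a b b' => by simp)
  have hB : ∀ x y : G, B (.ofMul (.of x)) (.ofMul (.of y)) = .ofMul (commutatorHom G x y) :=
    fun _ _ => rfl
  have halt : B.IsAlt := by
    intro v
    obtain ⟨x, rfl⟩ : ∃ x : G, Additive.ofMul (Abelianization.of x) = v :=
      QuotientGroup.mk_surjective v.toMul
    rw [hB, ofMul_eq_zero, commutatorHom_eq_one_iff, commutatorElement_self]
    exact one_mem _
  have hsurj : ∀ v, v ≠ 0 → Function.Surjective (B v) := by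
    intro v hv w
    obtain ⟨x, rfl⟩ : ∃ x : G, Additive.ofMul (Abelianization.of x) = v :=
      QuotientGroup.mk_surjective v.toMul
    have hx : x ∉ commutator G := fun h => hv
      (congrArg Additive.ofMul (monoidHom_eq_one_of_mem_commutator Abelianization.of h))
    obtain ⟨y, hy⟩ := hG.commutatorHom_surjective hx w.toMul
    exact ⟨.ofMul (.of y), by rw [hB, hy]; rfl⟩
  obtain ⟨x, hx⟩ := exists_notMem_commutator hz hne
  have : Nontrivial (Additive (Abelianization G)) :=
    ⟨.ofMul (.of x), 0, fun h => hx ((QuotientGroup.eq_one_iff x).1 (congrArg Additive.toMul h))⟩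
  have : Finite (Additive (Abelianization G)) := inferInstanceAs (Finite (G ⧸ commutator G))
  have : Finite (Additive (DerivedQuotient G)) := inferInstanceAs (Finite (DerivedQuotient G))
  exact ⟨m₁, m₂, B, hB, halt, hsurj, two_mul_finrank_le_of_surjective B halt hsurj⟩

theorem IsCamina.card_derivedQuotient_sq_le :
    Nat.card (DerivedQuotient G) ^ 2 ≤ (commutator G).index := by
  obtain ⟨m₁, m₂, B, -, -, -, hdim⟩ := hG.exists_bilin hz hne hp
  have : Finite (Additive (Abelianization G)) := inferInstanceAs (Finite (G ⧸ commutator G))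
  have : Finite (Additive (DerivedQuotient G)) := inferInstanceAs (Finite (DerivedQuotient G))
  have h1 : Nat.card (DerivedQuotient G) =
      p ^ finrank (ZMod p) (Additive (DerivedQuotient G)) := by
    have := Module.natCard_eq_pow_finrank (K := ZMod p) (V := Additive (DerivedQuotient G))
    rw [Nat.card_zmod] at this
    exact this
  have h2 : (commutator G).index = p ^ finrank (ZMod p) (Additive (Abelianization G)) := by
    have := Module.natCard_eq_pow_finrank (K := ZMod p) (V := Additive (Abelianization G))
    rw [Nat.card_zmod] at this
    exact this
  rw [h1, h2, ← pow_mul, mul_comm]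
  exact Nat.pow_le_pow_right (Fact.out : p.Prime).pos hdim

/-- The subgroups `C(N) / G_3` are abelian. -/
theorem IsCamina.commutator_mem_third_of_mem_subgroupC {N : Subgroup G} [N.Normal]
    (hNp : N.relIndex (third G) = p) {x y : G} (hx : x ∈ subgroupC N)
    (hy : y ∈ subgroupC N) : ⁅x, y⁆ ∈ third G := by
  obtain ⟨m₁, m₂, B, hB, -, hsurj, hdim⟩ := hG.exists_bilin hz hne hp
  have : Finite (Additive (Abelianization G)) := inferInstanceAs (Finite (G ⧸ commutator G))
  have : Finite (Additive (DerivedQuotient G)) := inferInstanceAs (Finite (DerivedQuotient G))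
  obtain ⟨φ, hφ⟩ := exists_hom_third_of_relIndex_eq hNp
  let T := bilinOfMul p (A := DerivedQuotient G) (B := Abelianization G) (C := ZMod p)
    (fun w v => (derivedQuotientHom hz φ w v).toAdd) (fun a a' b => by simp) (fun a b b' => by simp)
  have hT : ∀ (c : commutator G) (u : G),
      T (.ofMul (c : DerivedQuotient G)) (.ofMul (.of u)) = 0 ↔ ⁅(c : G), u⁆ ∈ N := fun c u =>
    (toAdd_eq_zero (x := φ ⟨_, commutator_mem_third c.2 u⟩)).trans (hφ _)
  have hTflip : ∀ u : G, T.flip (.ofMul (.of u)) = 0 ↔ u ∈ subgroupC N := by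
    intro u
    rw [mem_subgroupC]
    constructor
    · intro h c hc
      exact (hT ⟨c, hc⟩ u).1 (LinearMap.congr_fun h _)
    · intro h
      ext w
      obtain ⟨c, rfl⟩ : ∃ c : commutator G, Additive.ofMul (c : DerivedQuotient G) = w :=
        QuotientGroup.mk_surjective w.toMul
      exact (hT c u).2 (h c c.2)
  -- T = 0 would put every generator of G_3 in N, against index p.
  have hT0 : T ≠ 0 := by
    intro h
    have hle : third G ≤ N := by
      refine Subgroup.commutator_le.2 fun c hc u _ => ?_
      exact (hT ⟨c, hc⟩ u).1 (by rw [h]; rfl)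
    rw [Subgroup.relIndex_eq_one.2 hle] at hNp
    exact (Fact.out : p.Prime).one_lt.ne hNp
  rw [← commutatorHom_eq_one_iff, ← ofMul_eq_zero, ← hB]
  refine eq_zero_of_mem_ker_flip B hsurj hdim T hT0 ?_ ((hTflip x).2 hx) ((hTflip y).2 hy)
  intro v w hv hw
  obtain ⟨x, rfl⟩ : ∃ x : G, Additive.ofMul (Abelianization.of x) = v :=
    QuotientGroup.mk_surjective v.toMul
  obtain ⟨y, rfl⟩ : ∃ x : G, Additive.ofMul (Abelianization.of x) = w :=
    QuotientGroup.mk_surjective w.toMul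
  ext u
  obtain ⟨u, rfl⟩ : ∃ x : G, Additive.ofMul (Abelianization.of x) = u :=
    QuotientGroup.mk_surjective u.toMul
  rw [hB, commutatorHom_apply]
  exact (hT _ _).2 (commutator_commutator_mem ((hTflip x).1 hv) ((hTflip y).1 hw) u)

end

/-! ### Indices of A(a) and the range of c ↦ [c,b] -/

/-- A(a) is the kernel of the surjection [a, ·] onto G'/G_3, so its index does not depend on a. -/
theorem IsCamina.index_subgroupA (hG : IsCamina G) {a : G} (ha : a ∉ commutator G) :
    (subgroupA a).index = Nat.card (DerivedQuotient G) := by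
  have h : subgroupA a = (commutatorHom G a).ker := by
    ext x
    rw [mem_subgroupA, MonoidHom.mem_ker, commutatorHom_eq_one_iff]
  rw [h, Subgroup.index_ker, MonoidHom.range_eq_top.2 (hG.commutatorHom_surjective ha),
    Subgroup.card_top]

/-- A proper subgroup of a finite `p`-group lies in a subgroup of index `p`. -/
theorem exists_le_index_eq {p : ℕ} [Fact p.Prime] {P : Type*} [Group P] [Finite P]
    (hP : IsPGroup p P) {H : Subgroup P} (hH : H ≠ ⊤) : ∃ K, H ≤ K ∧ K.index = p := by
  obtain ⟨n, hn⟩ := IsPGroup.iff_card.1 hP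
  obtain ⟨m, hm⟩ := IsPGroup.iff_card.1 (hP.to_subgroup H)
  have hp := (Fact.out : p.Prime)
  have hlt : m < n := by
    rw [← Nat.pow_lt_pow_iff_right hp.one_lt, ← hn, ← hm]
    exact lt_of_le_of_ne (Subgroup.card_le_card_group H) fun h => hH (Subgroup.eq_top_of_card_eq H h)
  obtain ⟨k, rfl⟩ : ∃ k, n = k + 1 := ⟨n - 1, by omega⟩
  obtain ⟨K, hK, hle⟩ := Sylow.exists_subgroup_card_pow_prime_le p (m := k)
    (by rw [hn]; exact pow_dvd_pow _ k.le_succ) H hm (by omega)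
  refine ⟨K, hle, ?_⟩
  have h := K.card_mul_index
  rw [hK, hn, pow_succ] at h
  exact Nat.eq_of_mul_eq_mul_left (pow_pos hp.pos k) h

/-- The homomorphism `c ↦ [c, b]` on `G'`, for `G_3` central. -/
def commutatorRight (hz : third G ≤ Subgroup.center G) (b : G) : commutator G →* G :=
  MonoidHom.mk' (fun c => ⁅(c : G), b⁆) fun c d => by
    have h := Subgroup.mem_center_iff.1 (hz (commutator_mem_third d.2 b))
    simp [commutatorElement_mul_left_eq_conj_mul, h]

theorem range_commutatorRight_le (hz : third G ≤ Subgroup.center G) (b : G) :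
    (commutatorRight hz b).range ≤ third G := by
  rintro _ ⟨c, rfl⟩
  exact commutator_mem_third c.2 b

/-- The central subgroup G_3 lies in the kernel. -/
theorem card_range_commutatorRight_le [Finite G] (hz : third G ≤ Subgroup.center G) (b : G) :
    Nat.card (commutatorRight hz b).range ≤ Nat.card (DerivedQuotient G) := by
  rw [← Subgroup.index_ker]
  refine Nat.le_of_dvd Nat.card_pos (Subgroup.index_dvd_of_le (H := (third G).subgroupOf _) ?_)
  intro c hc
  exact commutatorElement_eq_one_iff_mul_comm.2
    (Subgroup.mem_center_iff.1 (hz (Subgroup.mem_subgroupOf.1 hc)) b).symm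

/-- If the commutators of `b` with `G'` do not fill `G_3`, then `b` centralizes `G'` modulo a
subgroup of index `p` in `G_3`. -/
theorem exists_relIndex_eq_commutator_mem {p : ℕ} [Fact p.Prime] [Finite G] (hp : IsPGroup p G)
    (hz : third G ≤ Subgroup.center G) {b : G} (hb : (commutatorRight hz b).range ≠ third G) :
    ∃ N : Subgroup G, N ≤ third G ∧ N.relIndex (third G) = p ∧
      ∀ c ∈ commutator G, ⁅c, b⁆ ∈ N := by
  set R := (commutatorRight hz b).range
  have hR : ∀ c ∈ commutator G, ⁅c, b⁆ ∈ R := fun c hc => ⟨⟨c, hc⟩, rfl⟩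
  have hRle : R ≤ third G := range_commutatorRight_le hz b
  obtain ⟨K, hK, hKp⟩ := exists_le_index_eq (hp.to_subgroup (third G))
    (H := R.subgroupOf (third G)) fun h => hb (hRle.antisymm (Subgroup.subgroupOf_eq_top.1 h))
  refine ⟨K.map (third G).subtype, Subgroup.map_subtype_le K, ?_, fun c hc => ?_⟩
  · rw [Subgroup.relIndex, Subgroup.subgroupOf,
      Subgroup.comap_map_eq_self_of_injective (third G).subtype_injective, hKp]
  · exact ⟨⟨_, hRle (hR c hc)⟩, hK (Subgroup.mem_subgroupOf.2 (hR c hc)), rfl⟩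

end CaminaGroups

open CaminaGroups
theorem corollary5p4 (p : ℕ) (hp : p.Prime) (G : Type*) [Group G] [Finite G]
    (hpG : IsPGroup p G) (hCamina : CaminaGroups.IsCamina G)
    (hnil : Group.IsNilpotent G) (hclass : Group.nilpotencyClass G = 3)
    (hCA : CaminaGroups.familyC p G ⊂ CaminaGroups.familyA G) :
    (Nat.card (CaminaGroups.third G) : ℝ) ≤ Real.sqrt ((commutator G).index : ℝ) := by
  have : Fact p.Prime := ⟨hp⟩
  have hz : third G ≤ Subgroup.center G := by
    have h : (⊤ : Subgroup G).lowerCentralSeries 3 = ⊥ := by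
      rw [← hclass]; exact Subgroup.lowerCentralSeries_nilpotencyClass
    exact Subgroup.commutator_top_right_eq_bot_iff_le_center.1 h
  have hne : third G ≠ ⊥ := by
    intro h
    have h2 : Group.nilpotencyClass G ≤ 2 :=
      Subgroup.lowerCentralSeries_eq_bot_iff_nilpotencyClass_le.1 h
    omega
  have hsq := hCamina.card_derivedQuotient_sq_le hz hne hpG
  obtain ⟨hsub, A, ⟨b, hb, rfl⟩, hA⟩ := Set.ssubset_iff_exists.1 hCA
  have hrange : (commutatorRight hz b).range = third G := by
    by_contra hcon
    obtain ⟨N, hN, hNp, hbN⟩ := exists_relIndex_eq_commutator_mem hpG hz hcon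
    have hnorm : N.Normal := normal_of_le_third hclass hN
    have hmem : subgroupC N ∈ familyC p G := ⟨N, hnorm, hN, hNp, rfl⟩
    obtain ⟨a, ha, hCa⟩ := hsub hmem
    have hle : subgroupC N ≤ subgroupA b := fun x hx => mem_subgroupA.2
      (hCamina.commutator_mem_third_of_mem_subgroupC hz hne hpG hNp (mem_subgroupC.2 hbN) hx)
    -- Equal indices turn the inclusion into an equality, which would put A(b) in 𝒞(G).
    have hidx : (subgroupC N).index = (subgroupA b).index := by
      rw [hCa, hCamina.index_subgroupA ha, hCamina.index_subgroupA hb]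
    refine hA ?_
    have heq : subgroupC N = subgroupA b := by
      refine Subgroup.eq_of_le_of_card_ge hle (le_of_eq ?_)
      have h1 := (subgroupC N).card_mul_index
      have h2 := (subgroupA b).card_mul_index
      rw [hidx, ← h2] at h1
      exact (Nat.eq_of_mul_eq_mul_right (Nat.pos_of_ne_zero Subgroup.FiniteIndex.index_ne_zero)
        h1).symm
    exact heq ▸ hmem
  have hcard : Nat.card (third G) ≤ Nat.card (DerivedQuotient G) :=
    hrange ▸ card_range_commutatorRight_le hz b
  refine Real.le_sqrt_of_sq_le ?_
  exact_mod_cast (Nat.pow_le_pow_left hcard 2).trans hsq
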